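/- A tree is a partially ordered set $T$ in which the set of predecessors of every node is well-ordered; $T_\alpha$ is the set of nodes whose predecessors have order type $\alpha$, $T_{<\alpha}=\bigcup_{\xi<\alpha}T_\xi$, and the height of $T$ is the least $\alpha$ with $T_\alpha=\emptyset$. A cofinal branch of $T$ is a downward closed chain that meets every level $T_\alpha$ with $\alpha$ below the height of $T$. For a cardinal $\gamma$, the tree $T$ is called $\gamma$-regressive if for every limit ordinal $\alpha$ below the height of $T$ with $\mathrm{cf}(\alpha)<\gamma$ there is a function $f_\alpha:T_\alpha\to T_{<\alpha}$ such that $f_\alpha(x)<_T x$ for all $x\in T_\alpha$, and for all distinct $x,y\in T_\alpha$ at least one of $f_\alpha(x)$, $f_\alpha(y)$ is strictly above the meet of $x$ and $y$ (i.e. strictly above every $w$ with $w\le_T x$ and $w\le_T y$). For a regular uncountable cardinal $\lambda$, a weak $\lambda$-Kurepa-tree is a tree of height $\lambda$ all of whose levels have size at most $\lambda$ and which has at least $\lambda^+$ many cofinal branches. An uncountable cardinal $\kappa$ is compact (strongly compact) if for every cardinal $\mu$ there is a fine ultrafilter on $\mathcal P_\kappa\mu=\{x\subseteq\mu:|x|<\kappa\}$,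 i.e. a $\kappa$-complete ultrafilter that contains $\{x\in\mathcal P_\kappa\mu:\xi\in x\}$ for every $\xi<\mu$. Theorem. If $\kappa$ is a compact cardinal and $\lambda\ge\kappa$ is a regular cardinal, then there are no $\kappa$-regressive weak $\lambda$-Kurepa-trees. -/

import Mathlib

open Cardinal Ordinal

universe u

/-- A (set-theoretic) tree: a partial order in which the predecessors of every node are
well-ordered. In particular every set of functions with ordinal domains, ordered by
extension, is one. -/
class IsSetTree (T : Type*) [PartialOrder T] : Prop where
  isWellOrder_Iio : ∀ t : T, IsWellOrder (Set.Iio t) (· < ·)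

namespace SetTree

/-- The set `P_κ(lam)` of all subsets of `lam` of cardinality less than `κ`. -/
abbrev PKappa (κ lam : Cardinal.{u}) : Type u :=
  {x : Set lam.ord.ToType // #x < κ}

/-- A fine ultrafilter on `P_κ(lam)`: a `κ`-complete ultrafilter that contains
`{x | ξ ∈ x}` for every `ξ < lam`. -/
structure IsFineUltrafilter (κ lam : Cardinal.{u}) (U : Ultrafilter (PKappa κ lam)) : Prop where
  complete : CardinalInterFilter (U : Filter (PKappa κ lam)) κ
  fine : ∀ ξ : lam.ord.ToType, {x : PKappa κ lam | ξ ∈ x.1} ∈ U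

/-- `κ` is `lam`-compact: there is a fine ultrafilter on `P_κ(lam)`. -/
def IsLamCompact (κ lam : Cardinal.{u}) : Prop :=
  ∃ U : Ultrafilter (PKappa κ lam), IsFineUltrafilter κ lam U

/-- Compact (also called strongly compact) cardinals: uncountable cardinals `κ` that are
`lam`-compact for all cardinals `lam`. -/
structure IsCompactCardinal (κ : Cardinal.{u}) : Prop where
  uncountable : ℵ₀ < κ
  isLamCompact : ∀ lam : Cardinal.{u}, IsLamCompact κ lam

variable {T : Type u} [PartialOrder T] [IsSetTree T]

/-- The height of a node: the order type of its set of predecessors. -/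
noncomputable def nodeHeight (t : T) : Ordinal.{u} :=
  haveI : IsWellOrder (Set.Iio t) (· < ·) := IsSetTree.isWellOrder_Iio t
  Ordinal.type (fun a b : Set.Iio t => a < b)

variable (T)

/-- The level `T_α`. -/
def level (α : Ordinal.{u}) : Set T := {t | nodeHeight t = α}

/-- The height of the tree: the supremum of `nodeHeight t + 1` over all nodes, which is the
least ordinal `α` such that the level `T_α` is empty. -/
noncomputable def treeHeight : Ordinal.{u} := ⨆ t : T, Order.succ (nodeHeight t)

variable {T}

/-- A cofinal branch: a downward closed chain that meets every level below the height of
the tree. -/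
structure IsCofinalBranch (b : Set T) : Prop where
  isChain : IsChain (· ≤ ·) b
  isLowerSet : IsLowerSet b
  meets : ∀ α < treeHeight T, (b ∩ level T α).Nonempty

/-- The node `z` is strictly above the meet of `x` and `y`, i.e. strictly above every common
node of the (closed) paths below `x` and below `y`. -/
def StrictlyAboveMeet (z x y : T) : Prop :=
  ∀ w : T, w ≤ x → w ≤ y → w < z

/-- `f : T_α → T_{<α}` is regressive. The codomain needs no separate condition, because
`f x < x` already puts `f x` on a level below `α`. -/
structure IsRegressive {α : Ordinal.{u}} (f : level T α → T) : Prop where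
  lt : ∀ x : level T α, f x < x
  aboveMeet : ∀ x y : level T α, x ≠ y →
    StrictlyAboveMeet (f x) (x : T) y ∨ StrictlyAboveMeet (f y) (x : T) y

variable (T)

/-- `T` is `γ`-regressive: each limit level of `T` of cofinality less than `γ` carries a
regressive function. -/
def IsRegressiveTree (γ : Cardinal.{u}) : Prop :=
  ∀ α : Ordinal.{u}, α < treeHeight T → Order.IsSuccLimit α → α.cof < γ →
    ∃ f : level T α → T, IsRegressive f

/-- `T` is a weak `lam`-Kurepa-tree: it has height `lam`, levels of size at most `lam`, and
(at least) `lam⁺` many cofinal branches. -/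
structure IsWeakKurepa (lam : Cardinal.{u}) : Prop where
  height_eq : treeHeight T = lam.ord
  card_level_le : ∀ α : Ordinal.{u}, #(level T α) ≤ lam
  card_branches : Order.succ lam ≤ #{b : Set T // IsCofinalBranch b}

end SetTree

/-! Let `h` represent the supremum of the constants below `lam` in the ultrapower by a fine
ultrafilter `U`. Fineness makes `h x` almost everywhere a limit below `lam` of cofinality less than
`κ`, so level `h x` carries a regressive `f x`. Along a branch, the height of the value of `f x` is
below `h x`, hence by leastness of `h` bounded almost everywhere by one `β < lam`. Send each branch
to its node on such a level `β`. The tree has at most `lam` nodes, so two distinct branches share a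
node `t`. For some `x` with `h x` above both `t` and the splitting of the branches, their nodes on
level `h x` are distinct and above `t`, so one of the two values of `f x` is strictly above `t`,
against the bound. -/

open Filter in
/-- Strict comparison of ordinal-valued functions modulo a countably complete proper filter is
well-founded. -/
theorem wellFounded_eventually_lt {I : Type*} (l : Filter I) [l.NeBot] [CountableInterFilter l] :
    WellFounded (fun g h : I → Ordinal.{u} => ∀ᶠ x in l, g x < h x) := by
  rw [wellFounded_iff_isEmpty_descending_chain]
  refine ⟨fun ⟨f, hf⟩ => ?_⟩
  -- By countable completeness, a single `x` witnesses all the inequalities of the descending chain.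
  obtain ⟨x, hx⟩ := (eventually_countable_forall.2 hf).exists
  exact (wellFounded_iff_isEmpty_descending_chain.1
    (wellFounded_lt (α := Ordinal.{u}))).false ⟨fun n => f n x, hx⟩

open Filter in
/-- In the ultrapower of the ordinals by a countably complete ultrafilter, the classes of the
constants below `δ` have a least strict upper bound. -/
theorem exists_least_strict_upper_bound {I : Type*} (U : Ultrafilter I)
    [CountableInterFilter (U : Filter I)] (δ : Ordinal.{u}) :
    ∃ h : I → Ordinal.{u}, (∀ β < δ, ∀ᶠ x in U, β < h x) ∧
      ∀ g : I → Ordinal.{u}, (∀ β < δ, ∀ᶠ x in U, β < g x) → ∀ᶠ x in U, h x ≤ g x := by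
  have wf := wellFounded_eventually_lt.{u} (U : Filter I)
  let S : Set (I → Ordinal.{u}) := {g | ∀ β < δ, ∀ᶠ x in U, β < g x}
  have hS : S.Nonempty := ⟨fun _ => δ, fun β hβ => Eventually.of_forall fun _ => hβ⟩
  refine ⟨wf.min S hS, wf.min_mem S hS, fun g hg => ?_⟩
  have := wf.not_lt_min S hg
  rw [← Ultrafilter.eventually_not] at this
  simpa only [not_lt] using this

namespace SetTree

section Nodes

variable {T : Type u} [PartialOrder T] [IsSetTree T]

theorem nodeHeight_strictMono : StrictMono (nodeHeight : T → Ordinal.{u}) := by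
  intro s t hst
  have := IsSetTree.isWellOrder_Iio t
  have := IsSetTree.isWellOrder_Iio s
  unfold nodeHeight
  rw [Ordinal.type_lt_iff]
  refine ⟨⟨⟨⟨fun a => ⟨a.1, a.2.trans hst⟩, fun a b h => ?_⟩, Iff.rfl⟩, ⟨s, hst⟩, fun b => ?_⟩⟩
  · exact Subtype.ext (congrArg (fun c : Set.Iio t => c.1) h)
  · constructor
    · rintro ⟨a, rfl⟩
      exact a.2
    · intro hb
      exact ⟨⟨b.1, hb⟩, rfl⟩

theorem nodeHeight_lt_treeHeight (t : T) : nodeHeight t < treeHeight T :=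
  (Order.lt_succ _).trans_le (Ordinal.le_iSup (fun t : T => Order.succ (nodeHeight t)) t)

theorem IsChain.le_of_nodeHeight_le {b : Set T} (hb : IsChain (· ≤ ·) b) {s t : T} (hs : s ∈ b)
    (ht : t ∈ b) (h : nodeHeight s ≤ nodeHeight t) : s ≤ t := by
  rcases hb.total hs ht with h' | h'
  · exact h'
  · rcases h'.lt_or_eq with h'' | h''
    · exact absurd (nodeHeight_strictMono h'') h.not_gt
    · exact h''.ge

/-- A chain has at most one node on each level, so the common node on the level of `s` is `s`
itself. -/
theorem IsCofinalBranch.subset_of_forall_level {b c : Set T} (hb : IsCofinalBranch b)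
    (h : ∀ α < treeHeight T, ∃ t ∈ level T α, t ∈ b ∧ t ∈ c) : b ⊆ c := by
  intro s hs
  obtain ⟨t, ht, htb, htc⟩ := h _ (nodeHeight_lt_treeHeight s)
  have : s = t := le_antisymm (IsChain.le_of_nodeHeight_le hb.isChain hs htb ht.ge)
    (IsChain.le_of_nodeHeight_le hb.isChain htb hs ht.le)
  exact this ▸ htc

theorem IsCofinalBranch.exists_level_disjoint {b c : Set T} (hb : IsCofinalBranch b)
    (hc : IsCofinalBranch c) (hne : b ≠ c) :
    ∃ α < treeHeight T, ∀ t ∈ level T α, t ∈ b → t ∉ c := by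
  by_contra! h
  exact hne ((hb.subset_of_forall_level h).antisymm (hc.subset_of_forall_level fun α hα =>
    let ⟨t, ht, htb, htc⟩ := h α hα
    ⟨t, ht, htc, htb⟩))

variable (T) in
theorem mk_le_of_card_level_le {lam : Cardinal.{u}} (hlam : ℵ₀ ≤ lam)
    (hh : treeHeight T = lam.ord) (hl : ∀ α : Ordinal.{u}, #(level T α) ≤ lam) : #T ≤ lam := by
  have hcov : (⋃ ξ : lam.ord.ToType, level T (ξ.toOrd : Ordinal.{u})) = Set.univ := by
    refine Set.eq_univ_of_forall fun t => Set.mem_iUnion.2 ?_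
    refine ⟨Ordinal.ToType.mk ⟨nodeHeight t, hh ▸ nodeHeight_lt_treeHeight t⟩, ?_⟩
    simp [level]
  rw [← Cardinal.mk_univ, ← hcov]
  refine (Cardinal.mk_iUnion_le _).trans ?_
  rw [Cardinal.mk_ord_toType]
  exact (mul_le_mul_right (ciSup_le' fun ξ => hl _) _).trans (Cardinal.mul_eq_self hlam).le

end Nodes

open Filter in
/-- For a fine ultrafilter on `P_κ(lam)` and regular `lam`, the least strict upper bound of
the constants below `lam` in the ultrapower is, almost everywhere, a limit ordinal below `lam` of
cofinality less than `κ`. -/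
theorem eventually_least_strict_upper_bound {κ lam : Cardinal.{u}} (hlam : lam.IsRegular)
    (hle : κ ≤ lam) {U : Ultrafilter (PKappa κ lam)}
    (hfine : ∀ ξ : lam.ord.ToType, {x : PKappa κ lam | ξ ∈ x.1} ∈ U)
    {h : PKappa κ lam → Ordinal.{u}} (hh : ∀ β < lam.ord, ∀ᶠ x in U, β < h x)
    (hmin : ∀ g : PKappa κ lam → Ordinal.{u}, (∀ β < lam.ord, ∀ᶠ x in U, β < g x) →
      ∀ᶠ x in U, h x ≤ g x) :
    ∀ᶠ x in U, h x < lam.ord ∧ Order.IsSuccLimit (h x) ∧ (h x).cof < κ := by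
  have hlim : Order.IsSuccLimit lam.ord := Cardinal.isSuccLimit_ord hlam.aleph0_le
  have hmem : ∀ β < lam.ord, ∀ᶠ x : PKappa κ lam in U, ∃ ξ : ↥x.1, (ξ.1.toOrd : Ordinal.{u}) = β := by
    intro β hβ
    filter_upwards [hfine (Ordinal.ToType.mk ⟨β, hβ⟩)] with x hx
    exact ⟨⟨_, hx⟩, by simp⟩
  -- By regularity this supremum of fewer than `lam` ordinals stays below `lam`.
  have hsup : ∀ᶠ x : PKappa κ lam in U, h x ≤ ⨆ ξ : ↥x.1, ((ξ.1.toOrd : Ordinal.{u}) + 1) := by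
    refine hmin _ fun β hβ => ?_
    filter_upwards [hmem β hβ] with x ⟨ξ, hξ⟩
    refine lt_of_lt_of_le ?_ (Ordinal.le_iSup _ ξ)
    rw [hξ]
    exact Order.lt_add_one_iff.2 le_rfl
  -- Leastness of `h` makes `x ∩ h x` cofinal in `h x`; this gives both the limit property and the
  -- cofinality bound.
  have hcofinal : ∀ᶠ x : PKappa κ lam in U, h x ≤
      ⨆ ξ : ↥x.1, if (ξ.1.toOrd : Ordinal.{u}) < h x then (ξ.1.toOrd : Ordinal.{u}) else 0 := by
    refine hmin _ fun β hβ => ?_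
    -- The terms of the supremum carry no successor, so `β + 1 ∈ x` is used to exceed `β` strictly.
    have hβ' : β + 1 < lam.ord := by simpa using hlim.succ_lt hβ
    filter_upwards [hmem _ hβ', hh _ hβ'] with x ⟨ξ, hξ⟩ hx
    refine lt_of_lt_of_le ?_ (Ordinal.le_iSup _ ξ)
    rw [hξ, if_pos hx]
    exact Order.lt_add_one_iff.2 le_rfl
  have hzero : (0 : Ordinal.{u}) < lam.ord := hlim.bot_lt
  filter_upwards [hsup, hcofinal, hh 0 hzero] with x h₁ h₂ h₀
  have hlt : ∀ ξ : x.1, (if (ξ.1.toOrd : Ordinal.{u}) < h x then (ξ.1.toOrd : Ordinal.{u})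
      else 0) < h x := by
    intro ξ
    split_ifs with hξ
    exacts [hξ, h₀]
  have heq := h₂.antisymm (Ordinal.iSup_le fun ξ => (hlt ξ).le)
  refine ⟨h₁.trans_lt (Ordinal.iSup_add_one_lt_of_lt_cof ?_ fun ξ => ξ.1.toOrd.2), ?_, ?_⟩
  · rw [hlam.cof_ord]
    exact x.2.trans_le hle
  · refine ⟨?_, ?_⟩
    · simpa using h₀.ne'
    · intro a ha
      have ha' : a < h x := ha.lt
      rw [heq, Ordinal.lt_iSup_iff] at ha'
      obtain ⟨ξ, hξ⟩ := ha'
      exact ha.2 hξ (hlt ξ)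
  · by_contra! hcof
    exact (Ordinal.iSup_lt_of_lt_cof (x.2.trans_le hcof) hlt).not_ge heq.le

end SetTree

open SetTree Filter in
theorem theorem7 (κ lam : Cardinal.{u}) (hκ : SetTree.IsCompactCardinal κ)
    (hlam : lam.IsRegular) (hle : κ ≤ lam) :
    ¬ ∃ (T : Type u) (_ : PartialOrder T) (_ : IsSetTree T),
      SetTree.IsWeakKurepa T lam ∧ SetTree.IsRegressiveTree T κ := by
  rintro ⟨T, _, _, hK, hreg⟩
  obtain ⟨U, hU⟩ := hκ.isLamCompact lam
  have := hU.complete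
  have : CountableInterFilter (U : Filter (PKappa κ lam)) :=
    CardinalInterFilter.toCountableInterFilter _ hκ.uncountable
  obtain ⟨h, hh, hmin⟩ := exists_least_strict_upper_bound U lam.ord
  have hgood := eventually_least_strict_upper_bound hlam hle hU.fine hh hmin
  have hsel : ∀ x : PKappa κ lam, ∃ f : level T (h x) → T,
      h x < lam.ord ∧ Order.IsSuccLimit (h x) ∧ (h x).cof < κ → IsRegressive f := by
    intro x
    by_cases hx : h x < lam.ord ∧ Order.IsSuccLimit (h x) ∧ (h x).cof < κ
    · obtain ⟨f, hf⟩ := hreg (h x) (hK.height_eq ▸ hx.1) hx.2.1 hx.2.2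
      exact ⟨f, fun _ => hf⟩
    · exact ⟨fun t => t, fun hx' => absurd hx' hx⟩
  choose f hf using hsel
  -- Along each branch, the regressive functions are bounded by a constant.
  have hbound : ∀ b : {b : Set T // IsCofinalBranch b}, ∃ t ∈ b.1, ∀ᶠ x in U,
      ∃ s : level T (h x), (s : T) ∈ b.1 ∧ nodeHeight (f x s) ≤ nodeHeight t := by
    rintro ⟨b, hb⟩
    have hnode : ∀ x, ∃ β : Ordinal.{u}, h x < lam.ord ∧ Order.IsSuccLimit (h x) ∧
        (h x).cof < κ → β < h x ∧ ∃ s : level T (h x), (s : T) ∈ b ∧ nodeHeight (f x s) = β := by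
      intro x
      by_cases hx : h x < lam.ord ∧ Order.IsSuccLimit (h x) ∧ (h x).cof < κ
      · obtain ⟨s, hsb, hs⟩ := hb.meets (h x) (hK.height_eq ▸ hx.1)
        refine ⟨_, fun _ => ⟨?_, ⟨s, hs⟩, hsb, rfl⟩⟩
        exact (nodeHeight_strictMono ((hf x hx).lt ⟨s, hs⟩)).trans_eq hs
      · exact ⟨0, fun hx' => absurd hx' hx⟩
    choose g hg using hnode
    -- Since `g < h` almost everywhere, `g` cannot bound all constants below `lam`.
    have hng : ¬ ∀ β < lam.ord, ∀ᶠ x in U, β < g x := by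
      intro hcon
      obtain ⟨x, hx, hx'⟩ := (hgood.and (hmin g hcon)).exists
      exact ((hg x hx).1.trans_le hx').false
    push Not at hng
    obtain ⟨β, hβ, hβg⟩ := hng
    obtain ⟨t, htb, ht⟩ := hb.meets β (hK.height_eq ▸ hβ)
    refine ⟨t, htb, ?_⟩
    filter_upwards [hβg, hgood] with x hx hx'
    obtain ⟨-, s, hsb, hs⟩ := hg x hx'
    exact ⟨s, hsb, (hs.trans_le hx).trans_eq ht.symm⟩
  choose F hFmem hF using hbound
  have hninj : ¬ Function.Injective F := fun hinj =>
    ((Order.lt_succ lam).trans_le (hK.card_branches.trans ((Cardinal.mk_le_of_injective hinj).trans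
      (mk_le_of_card_level_le T hlam.aleph0_le hK.height_eq hK.card_level_le)))).false
  simp only [Function.Injective, not_forall] at hninj
  obtain ⟨⟨b, hb⟩, ⟨c, hc⟩, hbc, hne⟩ := hninj
  have hne' : b ≠ c := fun h => hne (Subtype.ext h)
  obtain ⟨β, hβ, hdisj⟩ := hb.exists_level_disjoint hc hne'
  have htb := hFmem ⟨b, hb⟩
  have hFb := hF ⟨b, hb⟩
  have htc := hFmem ⟨c, hc⟩
  have hFc := hF ⟨c, hc⟩
  rw [← hbc] at htc hFc
  generalize F ⟨b, hb⟩ = t at htb hFb htc hFc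
  have htlt : nodeHeight t < lam.ord := hK.height_eq ▸ nodeHeight_lt_treeHeight t
  obtain ⟨x, hx, ⟨s, hsb, hs⟩, ⟨s', hsc, hs'⟩, hxβ, hxt⟩ := (hgood.and (hFb.and (hFc.and
    ((hh β (hK.height_eq ▸ hβ)).and (hh _ htlt))))).exists
  obtain ⟨r, hrb, hr⟩ := hb.meets β hβ
  have hrs : r ≤ s := IsChain.le_of_nodeHeight_le hb.isChain hrb hsb
    ((hr.trans_lt hxβ).trans_eq s.2.symm).le
  -- Otherwise `c`, being downward closed, would contain the node `r` of `b` on the level `β` where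
  -- the branches differ.
  have hss' : s ≠ s' := by
    rintro rfl
    exact hdisj r hr hrb (hc.isLowerSet hrs hsc)
  have hts : t ≤ s := IsChain.le_of_nodeHeight_le hb.isChain htb hsb
    (hxt.trans_eq s.2.symm).le
  have hts' : t ≤ s' := IsChain.le_of_nodeHeight_le hc.isChain htc hsc
    (hxt.trans_eq s'.2.symm).le
  rcases (hf x hx).aboveMeet s s' hss' with h' | h'
  · exact (nodeHeight_strictMono (h' t hts hts')).not_ge hs
  · exact (nodeHeight_strictMono (h' t hts hts')).not_ge hs'
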